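/- Consider an oriented graph with a finite set of nodes and a finite set $\mathcal{A}$ of arcs, a finite set $\mathcal{N}$ of origin/destination (O/D) pairs of nodes and, for each $s\in\mathcal{N}$, a finite set $\mathcal{P}_s$ of directed paths from the origin to the destination of $s$ and a finite set $\mathcal{B}_s$ of pairs of users. (Flows and demands are indexed separately for different O/D pairs.) For path flows $x=(x_p)_{p\in\mathcal{P}_s,\,s\in\mathcal{N}}$ put $\alpha_{pa}=1$ if arc $a$ belongs to path $p$ and $\alpha_{pa}=0$ otherwise, and $$f_a=\sum_{s\in\mathcal{N}}\sum_{p\in\mathcal{P}_s}\alpha_{pa}x_p,\qquad g_p(x)=\sum_{a\in\mathcal{A}}\alpha_{pa}c_a(f),\qquad f=(f_a)_{a\in\mathcal{A}},$$ where $c_a$ is a real-valued function of the arc flow vector $f$ for each $a\in\mathcal{A}$. For each $j\in\mathcal{B}_s$, $s\in\mathcal{N}$, let $h_j$ be a real-valued function of the whole demand vector $y=(y_j)_{j\in\mathcal{B}_s,\,s\in\mathcal{N}}$, and let $\gamma_j$ be an upper bound for the demand $y_j$. Let $$W=\Bigl\{(x,y)\ :\ \sum_{p\in\mathcal{P}_s}x_p=\sum_{j\in\mathcal{B}_s}y_j,\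 \ x_p\ge 0\ \ \forall p\in\mathcal{P}_s,\ \ 0\le y_j\le\gamma_j\ \ \forall j\in\mathcal{B}_s,\ \ \forall s\in\mathcal{N}\Bigr\}.$$ **Theorem 4.1.** Suppose that $\gamma_j=+\infty$ for all $j\in\mathcal{B}_s$, $s\in\mathcal{N}$, that $W$ is nonempty, that all the functions $c_a$ and $h_j$ are continuous (on the nonnegative orthants of arc flow vectors and demand vectors, respectively), and that the following coercivity condition holds: (C1) there exists a number $r>0$ such that for every $(x,y)\in W$, every $s\in\mathcal{N}$ and every $j\in\mathcal{B}_s$ with $y_j>r$ there exists $p\in\mathcal{P}_s$ such that $x_p>0$ and $g_p(x)\ge h_j(y)$. Then there exists a pair $(x^*,y^*)\in W$ such that $$\sum_{s\in\mathcal{N}}\sum_{p\in\mathcal{P}_s}g_p(x^*)(x_p-x_p^*)-\sum_{s\in\mathcal{N}}\sum_{j\in\mathcal{B}_s}h_j(y^*)(y_j-y_j^*)\ge 0\qquad\forall (x,y)\in W.$$ -/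

import Mathlib

/-- `IsDirectedPath src dst i j p`: the list of arcs `p` is a directed path from node `i` to
node `j`, i.e. the arcs are consecutive, the first one starts at `i` and the last one ends at `j`.
Nodes are allowed to repeat, so this covers both the simple-path and the general convention. -/
def IsDirectedPath {V A : Type*} (src dst : A → V) : V → V → List A → Prop
  | i, j, [] => i = j
  | i, j, a :: p => src a = i ∧ IsDirectedPath src dst (dst a) j p

/-- The combinatorial data of the network problem: an oriented graph with nodes `V` and arcs `A`,
a finite set of origin-destination pairs, and, for each O/D pair, a finite set of directed paths
from its origin to its destination and a finite set of pairs of users. -/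
structure ElasticNetwork (V A U : Type*) where
  /-- origin of an arc -/
  src : A → V
  /-- destination of an arc -/
  dst : A → V
  /-- the O/D pairs (origin, destination) -/
  odPairs : Finset (V × V)
  /-- the set of paths of an O/D pair -/
  paths : odPairs → Finset (List A)
  /-- every path of an O/D pair joins its origin to its destination -/
  isPath : ∀ s : odPairs, ∀ p ∈ paths s, IsDirectedPath src dst s.1.1 s.1.2 p
  /-- the set of pairs of users of an O/D pair -/
  users : odPairs → Finset U

namespace ElasticNetwork

variable {V A U : Type*}

/-- Path flow vectors: one number for each path of each O/D pair. -/
abbrev PathFlow (N : ElasticNetwork V A U) : Type _ :=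
  (s : N.odPairs) → N.paths s → ℝ

/-- Demand vectors: one number for each pair of users of each O/D pair. -/
abbrev Demand (N : ElasticNetwork V A U) : Type _ :=
  (s : N.odPairs) → N.users s → ℝ

open Classical in
/-- The path-arc incidence number: `1` if the arc `a` belongs to the path `p`, `0` otherwise. -/
noncomputable def incidence (p : List A) (a : A) : ℝ := if a ∈ p then 1 else 0

/-- The arc flows generated by a path flow vector. -/
noncomputable def arcFlow (N : ElasticNetwork V A U) (x : N.PathFlow) : A → ℝ :=
  fun a => ∑ s, ∑ p, incidence p.1 a * x s p

/-- The dis-utility of a path: the sum of the dis-utilities of its arcs at the current arc flows. -/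
noncomputable def pathCost [Fintype A] (N : ElasticNetwork V A U) (c : A → (A → ℝ) → ℝ)
    (x : N.PathFlow) (s : N.odPairs) (p : N.paths s) : ℝ :=
  ∑ a, incidence p.1 a * c a (N.arcFlow x)

/-- The set of feasible flow / demand pairs, for upper demand bounds `γ` (`⊤` means no bound). -/
def feasibleSet (N : ElasticNetwork V A U) (γ : (s : N.odPairs) → N.users s → EReal) :
    Set (N.PathFlow × N.Demand) :=
  {w | ∀ s, (∑ p, w.1 s p = ∑ j, w.2 s j) ∧ (∀ p, 0 ≤ w.1 s p) ∧
    (∀ j, 0 ≤ w.2 s j ∧ (w.2 s j : EReal) ≤ γ s j)}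

/-- The coercivity condition: there is `r > 0` such that at each feasible point, for each O/D pair
and each of its pairs of users whose demand exceeds `r`, some path of the O/D pair carries a
positive flow and has a dis-utility at least that of this pair of users. -/
def Coercive [Fintype A] (N : ElasticNetwork V A U)
    (γ : (s : N.odPairs) → N.users s → EReal)
    (c : A → (A → ℝ) → ℝ) (h : (s : N.odPairs) → N.users s → N.Demand → ℝ) : Prop :=
  ∃ r : ℝ, 0 < r ∧ ∀ w ∈ N.feasibleSet γ, ∀ s, ∀ j : N.users s, r < w.2 s j →
    ∃ p : N.paths s, 0 < w.1 s p ∧ h s j w.2 ≤ N.pathCost c w.1 s p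

/-- `w` solves the variational inequality of the network equilibrium problem. -/
def SolvesVI [Fintype A] (N : ElasticNetwork V A U)
    (γ : (s : N.odPairs) → N.users s → EReal)
    (c : A → (A → ℝ) → ℝ) (h : (s : N.odPairs) → N.users s → N.Demand → ℝ)
    (w : N.PathFlow × N.Demand) : Prop :=
  w ∈ N.feasibleSet γ ∧ ∀ v ∈ N.feasibleSet γ,
    0 ≤ (∑ s, ∑ p, N.pathCost c w.1 s p * (v.1 s p - w.1 s p))
      - ∑ s, ∑ j, h s j w.2 * (v.2 s j - w.2 s j)

end ElasticNetwork

/-! Cap every demand at `r + 1` and attach a multiplier `l s` to each balance equation. In the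
variables (flows, demands, multipliers) the equilibrium conditions become a complementarity problem
on a box, solvable because the projection of `z - F z` onto the box has a fixed point. If the
multiplier bounds exceed all costs and dis-utilities, an unbalanced O/D pair would contradict
complementarity (`exists_elastic_equilibrium`). Used paths then cost exactly `l s`, and only a
demand at the cap could have `h` above `l s`. Such a demand exceeds `r`, so (C1) gives a used path
with `h ≤ g_p ≤ l s`. Hence the cap does no harm, and comparing both sums with `l s` proves the
variational inequality on all of `W`.

The fixed point comes from Brouwer's theorem, via a KKM lemma and a Sperner-type lemma on grid
points. In place of a triangulation, Scarf's dominating sets act as the cells: a set one point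
smaller lies in an even number of them, apart from one boundary set, and a parity count yields a
cell with all colours. -/

/-! ### Parity of doors and rooms -/

/-- If a colouring of an `n`-set misses a colour, then the number of its subsets carrying each colour
other than `i₀` exactly once is even. -/
theorem even_card_subsets_image_eq_erase {T I : Type*} [DecidableEq T] [Fintype I]
    [DecidableEq I] (c : T → I) (i₀ : I) (R : Finset T) (hR : R.card = Fintype.card I)
    (hc : R.image c ≠ Finset.univ) :
    Even (R.powerset.filter fun τ =>
      τ.card + 1 = Fintype.card I ∧ τ.image c = Finset.univ.erase i₀).card := by
  classical
  set S := R.powerset.filter fun τ =>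
      τ.card + 1 = Fintype.card I ∧ τ.image c = Finset.univ.erase i₀ with hS
  have key : ∀ τ ∈ S, ∃ x ∈ R, τ = R.erase x := by
    intro τ hτ
    simp only [hS, Finset.mem_filter, Finset.mem_powerset] at hτ
    obtain ⟨h1, h2, h3⟩ := hτ
    have : (R \ τ).card = 1 := by
      rw [Finset.card_sdiff_of_subset h1]; omega
    obtain ⟨x, hx⟩ := Finset.card_eq_one.1 this
    have hxm : x ∈ R \ τ := by rw [hx]; simp
    refine ⟨x, (Finset.mem_sdiff.1 hxm).1, ?_⟩
    rw [← Finset.sdiff_singleton_eq_erase, ← hx, Finset.sdiff_sdiff_eq_self h1]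
  rcases S.eq_empty_or_nonempty with h | ⟨τ, hτ⟩
  · simp [h]
  obtain ⟨x, hxR, rfl⟩ := key τ hτ
  have hτ' := hτ
  simp only [hS, Finset.mem_filter, Finset.mem_powerset] at hτ'
  obtain ⟨h1, h2, h3⟩ := hτ'
  have hcx : c x ≠ i₀ := by
    intro h
    apply hc
    rw [← Finset.insert_erase hxR, Finset.image_insert, h3, h]
    exact Finset.insert_erase (Finset.mem_univ _)
  have hcx' : c x ∈ (R.erase x).image c := by rw [h3]; simp [hcx]
  -- `x` and `y` share a colour, so removing either leaves the same colours. Removing a third point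
  -- keeps both, and too few colours remain.
  obtain ⟨y, hy, hyx⟩ := Finset.mem_image.1 hcx'
  obtain ⟨hyne, hyR⟩ := Finset.mem_erase.1 hy
  have himg : (R.erase y).image c = (R.erase x).image c := by
    ext i
    simp only [Finset.mem_image, Finset.mem_erase]
    constructor
    · rintro ⟨z, ⟨hz, hzR⟩, rfl⟩
      by_cases hzx : z = x
      · exact ⟨y, ⟨hyne, hyR⟩, by rw [hyx, hzx]⟩
      · exact ⟨z, ⟨hzx, hzR⟩, rfl⟩
    · rintro ⟨z, ⟨hz, hzR⟩, rfl⟩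
      by_cases hzy : z = y
      · exact ⟨x, ⟨hyne.symm, hxR⟩, by rw [← hyx, hzy]⟩
      · exact ⟨z, ⟨hzy, hzR⟩, rfl⟩
  have : S = {R.erase x, R.erase y} := by
    ext ρ
    simp only [Finset.mem_insert, Finset.mem_singleton]
    constructor
    · intro hρ
      obtain ⟨z, hz, rfl⟩ := key ρ hρ
      by_contra hne
      have hzx : z ≠ x := fun h => hne (Or.inl (by rw [h]))
      have hzy : z ≠ y := fun h => hne (Or.inr (by rw [h]))
      simp only [hS, Finset.mem_filter, Finset.mem_powerset] at hρ
      obtain ⟨-, g2, g3⟩ := hρ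
      have hinj : Set.InjOn c (R.erase z : Finset T) := by
        rw [← Finset.card_image_iff, g3, Finset.card_erase_of_mem (Finset.mem_univ _),
          Finset.card_univ]
        omega
      exact hyne (hinj (by simp [hzy.symm, hyR]) (by simp [hzx.symm, hxR]) hyx)
    · rintro (rfl | rfl)
      · exact hτ
      · simp only [hS, Finset.mem_filter, Finset.mem_powerset]
        refine ⟨Finset.erase_subset _ _, ?_, himg.trans h3⟩
        rw [Finset.card_erase_add_one hyR, hR]
  rw [this, Finset.card_pair]
  · exact even_two
  · intro h
    have : x ∈ R.erase y := by simp [hyne.symm, hxR]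
    rw [← h] at this
    simp at this

/-- Parity argument behind Sperner's lemma. -/
theorem exists_image_eq_univ_of_parity {T I : Type*} [Fintype T] [DecidableEq T] [Fintype I]
    [DecidableEq I] (c : T → I) (i₀ : I) (rooms : Finset (Finset T))
    (hcard : ∀ R ∈ rooms, R.card = Fintype.card I) (τ₀ : Finset T)
    (h₀ : τ₀.card + 1 = Fintype.card I) (h₀' : τ₀.image c = Finset.univ.erase i₀)
    (hodd : Odd (rooms.filter fun R => τ₀ ⊆ R).card)
    (heven : ∀ τ : Finset T, τ ≠ τ₀ → τ.card + 1 = Fintype.card I →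
      τ.image c = Finset.univ.erase i₀ → Even (rooms.filter fun R => τ ⊆ R).card) :
    ∃ R ∈ rooms, R.image c = Finset.univ := by
  classical
  by_contra! hno
  set doors := (Finset.univ : Finset (Finset T)).filter fun τ =>
    τ.card + 1 = Fintype.card I ∧ τ.image c = Finset.univ.erase i₀ with hdoors
  have hτ₀ : τ₀ ∈ doors := by simp [hdoors, h₀, h₀']
  -- Double count the pairs door ⊆ room: even when summed over rooms, odd when summed over doors
  -- because of `τ₀`.
  have hdc := Finset.sum_card_bipartiteAbove_eq_sum_card_bipartiteBelow
    (s := doors) (t := rooms) (fun τ R => τ ⊆ R)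
  have hR : Even (∑ R ∈ rooms, (doors.bipartiteBelow (fun τ R => τ ⊆ R) R).card) := by
    refine Finset.even_sum _ fun R hR => ?_
    have := even_card_subsets_image_eq_erase c i₀ R (hcard R hR) (hno R hR)
    have heq : doors.bipartiteBelow (fun τ R => τ ⊆ R) R = R.powerset.filter fun τ =>
        τ.card + 1 = Fintype.card I ∧ τ.image c = Finset.univ.erase i₀ := by
      ext τ
      simp only [Finset.bipartiteBelow, hdoors, Finset.mem_filter, Finset.mem_univ, true_and,
        Finset.mem_powerset]
      tauto
    rwa [heq]
  have hD : Odd (∑ τ ∈ doors, (rooms.bipartiteAbove (fun τ R => τ ⊆ R) τ).card) := by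
    rw [← Finset.add_sum_erase _ _ hτ₀]
    refine Odd.add_even hodd (Finset.even_sum _ fun τ hτ => ?_)
    simp only [hdoors, Finset.mem_erase, Finset.mem_filter, Finset.mem_univ, true_and] at hτ
    exact heven τ hτ.1 hτ.2.1 hτ.2.2
  rw [hdc] at hD
  exact Nat.not_even_iff_odd.2 hD hR

/-! ### Dominating sets and their pivots -/

/-- A set dominates if no point is strictly above the set in every one of the orders `r i`. -/
def IsDominating {T I α : Type*} [LE α] (r : I → T → α) (R : Finset T) : Prop :=
  ∀ y, ∃ i, ∀ x ∈ R, r i y ≤ r i x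

theorem IsDominating.mono {T I α : Type*} [LE α] {r : I → T → α} {R S : Finset T}
    (h : IsDominating r R) (hS : S ⊆ R) : IsDominating r S := fun y =>
  (h y).imp fun _ hi x hx => hi x (hS hx)

section Pivot

variable {T I α : Type*} [DecidableEq T] [LinearOrder α]
  {r : I → T → α}

/-- Existence of the pivot of a dominating set in a direction `k` that is not needed to reach
all its points as minima. -/
theorem IsDominating.exists_pivot [Fintype T] {τ : Finset T} (hτ : IsDominating r τ) {m : I → T}
    (hm : ∀ i, m i ∈ τ) (hmin : ∀ i, ∀ x ∈ τ, r i (m i) ≤ r i x) {k : I}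
    (hk : ∀ t ∈ τ, ∃ l, l ≠ k ∧ m l = t) (hne : ∃ y, ∀ l, l ≠ k → r l (m l) < r l y) :
    ∃ x, x ∉ τ ∧ (∀ l, l ≠ k → r l (m l) < r l x) ∧ (∀ t ∈ τ, r k x ≤ r k t) ∧
      IsDominating r (insert x τ) ∧
      ∀ y, (∀ l, l ≠ k → r l (m l) < r l y) → r k y ≤ r k x := by
  classical
  obtain ⟨x, hx, hmax⟩ := Finset.exists_max_image
    (Finset.univ.filter fun y => ∀ l, l ≠ k → r l (m l) < r l y) (r k)
    (by obtain ⟨y, hy⟩ := hne; exact ⟨y, by simpa using hy⟩)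
  simp only [Finset.mem_filter, Finset.mem_univ, true_and] at hx hmax
  have hxτ : x ∉ τ := by
    intro h
    obtain ⟨l, hl, hlx⟩ := hk x h
    have := hx l hl
    rw [hlx] at this
    exact lt_irrefl _ this
  -- Only order `k` can witness that `τ` dominates `x`, since `x` beats the minima of all the
  -- others.
  have hle : ∀ t ∈ τ, r k x ≤ r k t := by
    obtain ⟨l, hl⟩ := hτ x
    by_cases hlk : l = k
    · rwa [hlk] at hl
    · exact absurd (hl _ (hm l)) (not_le.2 (hx l hlk))
  refine ⟨x, hxτ, hx, hle, ?_, hmax⟩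
  intro y
  by_cases hy : ∀ l, l ≠ k → r l (m l) < r l y
  · refine ⟨k, fun z hz => ?_⟩
    rcases Finset.mem_insert.1 hz with rfl | hz
    · exact hmax y hy
    · exact (hmax y hy).trans (hle z hz)
  · push Not at hy
    obtain ⟨l, hl, hly⟩ := hy
    refine ⟨l, fun z hz => ?_⟩
    rcases Finset.mem_insert.1 hz with rfl | hz
    · exact hly.trans (hx l hl).le
    · exact hly.trans (hmin l z hz)

/-- In a dominating set with as many points as there are orders, different orders have different
minimal points. -/
theorem IsDominating.eq_of_isMin [Fintype I] {R : Finset T} (hr : ∀ i, Function.Injective (r i))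
    (hR : IsDominating r R) (hcard : R.card = Fintype.card I) {x : T} (hx : x ∈ R) {i j : I}
    (hi : ∀ t ∈ R, r i x ≤ r i t) (hj : ∀ t ∈ R, r j x ≤ r j t) : i = j := by
  classical
  choose m hm hmin using fun i => Finset.exists_min_image R (r i) ⟨x, hx⟩
  have huniq : ∀ i, ∀ x ∈ R, (∀ t ∈ R, r i x ≤ r i t) → m i = x := fun i x hx h =>
    hr i (le_antisymm (hmin i x hx) (h _ (hm i)))
  -- Domination applied to a point of `R` itself makes that point a minimum of `R`; equal
  -- cardinalities then make `m` injective.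
  have himg : Finset.univ.image m = R := by
    ext t
    simp only [Finset.mem_image, Finset.mem_univ, true_and]
    constructor
    · rintro ⟨i, rfl⟩
      exact hm i
    · intro ht
      obtain ⟨i, hi⟩ := hR t
      exact ⟨i, huniq i t ht hi⟩
  have hinj : Set.InjOn m (Finset.univ : Finset I) := by
    rw [← Finset.card_image_iff, himg, hcard, Finset.card_univ]
  exact hinj (by simp) (by simp) ((huniq i x hx hi).trans (huniq j x hx hj).symm)

/-- A nonempty set with one point less than there are orders lies in an even number of dominating
sets with as many points as there are orders, provided it has a pivot in each direction. -/
theorem even_card_dominating_supersets [Fintype T] [Fintype I]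
    (hr : ∀ i, Function.Injective (r i)) {τ : Finset T}
    (hτcard : τ.card + 1 = Fintype.card I) (hτne : τ.Nonempty)
    (hne : ∀ k, ∃ y, ∀ l, l ≠ k → ∃ t ∈ τ, r l t < r l y) (rooms : Finset (Finset T))
    (hrooms : ∀ R, R ∈ rooms ↔ R.card = Fintype.card I ∧ IsDominating r R) :
    Even (rooms.filter fun R => τ ⊆ R).card := by
  classical
  by_cases hτ : IsDominating r τ
  swap
  · rw [Finset.filter_eq_empty_iff.2]
    · simp
    · intro R hR hs
      exact hτ (((hrooms R).1 hR).2.mono hs)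
  choose m hm hmin using fun i => Finset.exists_min_image τ (r i) hτne
  have huniq : ∀ i, ∀ x ∈ τ, (∀ t ∈ τ, r i x ≤ r i t) → m i = x := fun i x hx h =>
    hr i (le_antisymm (hmin i x hx) (h _ (hm i)))
  have hsurj : ∀ t ∈ τ, ∃ i, m i = t := fun t ht => by
    obtain ⟨i, hi⟩ := hτ t
    exact ⟨i, huniq i t ht hi⟩
  -- There is one more order than there are points, so exactly one point is the minimum twice, for
  -- `i` and `j`. Only these two directions can be pivoted.
  obtain ⟨i, -, j, -, hij, hmij⟩ := Finset.exists_ne_map_eq_of_card_lt_of_maps_to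
    (s := Finset.univ) (t := τ) (f := m) (by rw [Finset.card_univ]; omega) (fun i _ => hm i)
  have hpi : ∀ t ∈ τ, ∃ l, l ≠ i ∧ m l = t := by
    intro t ht
    obtain ⟨l, hl⟩ := hsurj t ht
    by_cases h : l = i
    · exact ⟨j, hij.symm, by rw [← hmij, ← h, hl]⟩
    · exact ⟨l, h, hl⟩
  have hpj : ∀ t ∈ τ, ∃ l, l ≠ j ∧ m l = t := by
    intro t ht
    obtain ⟨l, hl⟩ := hsurj t ht
    by_cases h : l = j
    · exact ⟨i, hij, by rw [hmij, ← h, hl]⟩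
    · exact ⟨l, h, hl⟩
  have hne' : ∀ k, ∃ y, ∀ l, l ≠ k → r l (m l) < r l y := fun k => by
    obtain ⟨y, hy⟩ := hne k
    refine ⟨y, fun l hl => ?_⟩
    obtain ⟨t, ht, hlt⟩ := hy l hl
    exact (hmin l t ht).trans_lt hlt
  obtain ⟨x, hxτ, hx1, hx2, hx3, hx4⟩ := hτ.exists_pivot hm hmin hpi (hne' i)
  obtain ⟨y, hyτ, hy1, hy2, hy3, hy4⟩ := hτ.exists_pivot hm hmin hpj (hne' j)
  have hxcard : (insert x τ).card = Fintype.card I := by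
    rw [Finset.card_insert_of_notMem hxτ, hτcard]
  have hycard : (insert y τ).card = Fintype.card I := by
    rw [Finset.card_insert_of_notMem hyτ, hτcard]
  have hins : ∀ {k : I} {z : T}, (∀ t ∈ τ, r k z ≤ r k t) → ∀ t ∈ insert z τ, r k z ≤ r k t := by
    intro k z hz t ht
    rcases Finset.mem_insert.1 ht with rfl | ht
    · exact le_rfl
    · exact hz t ht
  have hxy : x ≠ y := by
    rintro rfl
    exact hij (hx3.eq_of_isMin hr hxcard (Finset.mem_insert_self _ _) (hins hx2) (hins hy2))
  have : (rooms.filter fun R => τ ⊆ R) = {insert x τ, insert y τ} := by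
    ext R
    simp only [Finset.mem_filter, hrooms, Finset.mem_insert, Finset.mem_singleton]
    constructor
    · rintro ⟨⟨hRc, hRd⟩, hs⟩
      obtain ⟨z, hz⟩ := Finset.card_eq_one.1 (show (R \ τ).card = 1
        by rw [Finset.card_sdiff_of_subset hs]; omega)
      have hzm : z ∈ R \ τ := by rw [hz]; simp
      obtain ⟨hzR, hzτ⟩ := Finset.mem_sdiff.1 hzm
      obtain rfl : R = insert z τ := by
        rw [← Finset.sdiff_union_of_subset hs, hz]; rfl
      obtain ⟨k, hk⟩ := hRd z
      have hlow : ∀ l, l ≠ k → r l (m l) < r l z := by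
        intro l hl
        by_contra! hcon
        refine hl (hRd.eq_of_isMin hr hRc (Finset.mem_insert_self _ _) (hins fun t ht => ?_) hk)
        exact hcon.trans (hmin l t ht)
      have hk' : ∀ t ∈ τ, ∃ l, l ≠ k ∧ m l = t := by
        intro t ht
        obtain ⟨l, hl⟩ := hRd t
        refine ⟨l, ?_, huniq l t ht fun u hu => hl u (Finset.mem_insert_of_mem hu)⟩
        rintro rfl
        exact hzτ (hr l (le_antisymm (hk t (Finset.mem_insert_of_mem ht))
          (hl z (Finset.mem_insert_self _ _))) ▸ ht)
      -- Otherwise `k` and `i` could both be dropped, leaving too few orders to reach every point of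
      -- `τ`.
      have hkij : k = i ∨ k = j := by
        by_contra! hcon
        have hsub : τ ⊆ ((Finset.univ.erase k).erase i).image m := by
          intro t ht
          obtain ⟨l, hl, hlt⟩ := hk' t ht
          by_cases h : l = i
          · refine Finset.mem_image.2 ⟨j, by simp [hcon.2.symm, hij.symm], ?_⟩
            rw [← hmij, ← h, hlt]
          · exact Finset.mem_image.2 ⟨l, by simp [h, hl], hlt⟩
        have h1 := (Finset.card_le_card hsub).trans Finset.card_image_le
        rw [Finset.card_erase_of_mem (by simp [hcon.1.symm]),
          Finset.card_erase_of_mem (Finset.mem_univ _), Finset.card_univ] at h1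
        have := hτne.card_pos
        omega
      have hfin : ∀ x, (∀ l, l ≠ k → r l (m l) < r l x) →
          (∀ y, (∀ l, l ≠ k → r l (m l) < r l y) → r k y ≤ r k x) → z = x := by
        intro x hx1 hx4
        refine hr k (le_antisymm (hx4 z hlow) ?_)
        obtain ⟨l, hl⟩ := hRd x
        by_cases hlk : l = k
        · rw [← hlk]; exact hl z (Finset.mem_insert_self _ _)
        · exact absurd (hl _ (Finset.mem_insert_of_mem (hm l))) (not_le.2 (hx1 l hlk))
      rcases hkij with rfl | rfl
      · left; rw [hfin x hx1 hx4]
      · right; rw [hfin y hy1 hy4]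
    · rintro (rfl | rfl)
      · exact ⟨⟨hxcard, hx3⟩, Finset.subset_insert _ _⟩
      · exact ⟨⟨hycard, hy3⟩, Finset.subset_insert _ _⟩
  rw [this, Finset.card_pair]
  · exact even_two
  · intro h
    have : x ∈ insert y τ := h ▸ Finset.mem_insert_self x τ
    rcases Finset.mem_insert.1 this with h | h
    · exact hxy h
    · exact hxτ h

end Pivot

/-! ### Sperner's lemma on the integer grid of a simplex -/

section Grid

variable {I : Type*} [Fintype I] [DecidableEq I]

/-- The height of the vertex `t` in direction `i`: a grid point has its coordinate (plus one), the
slack vertex `i` lies below all grid points and the other slack vertices above them. -/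
def slackHeight (N : ℕ) (i : I) : I ⊕ Finset.piAntidiag (Finset.univ : Finset I) N → ℕ
  | Sum.inl j => if j = i then 0 else N + 2
  | Sum.inr a => a.1 i + 1

/-- The order `i` on vertices: by height, ties being broken by an enumeration. -/
noncomputable def slackOrder (N : ℕ) (i : I)
    (t : I ⊕ Finset.piAntidiag (Finset.univ : Finset I) N) : ℕ ×ₗ ℕ :=
  toLex (slackHeight N i t, (Fintype.equivFin _ t : ℕ))

theorem slackOrder_injective (N : ℕ) (i : I) : Function.Injective (slackOrder N i) := by
  intro s t h
  simp only [slackOrder, EmbeddingLike.apply_eq_iff_eq, Prod.mk.injEq] at h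
  exact (Fintype.equivFin _).injective (Fin.ext h.2)

theorem slackOrder_lt {N : ℕ} {i : I} {s t : I ⊕ Finset.piAntidiag (Finset.univ : Finset I) N}
    (h : slackHeight N i s < slackHeight N i t) : slackOrder N i s < slackOrder N i t :=
  Prod.Lex.toLex_lt_toLex.2 (Or.inl h)

theorem slackHeight_le {N : ℕ} {i : I} {s t : I ⊕ Finset.piAntidiag (Finset.univ : Finset I) N}
    (h : slackOrder N i s ≤ slackOrder N i t) : slackHeight N i s ≤ slackHeight N i t := by
  by_contra! hcon
  exact absurd h (not_le.2 (slackOrder_lt hcon))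

theorem piAntidiag_apply_le {N : ℕ} (a : Finset.piAntidiag (Finset.univ : Finset I) N) (i : I) :
    a.1 i ≤ N := by
  exact (Finset.single_le_sum (f := a.1) (fun _ _ => Nat.zero_le _) (Finset.mem_univ i)).trans_eq
    (Finset.mem_piAntidiag.1 a.2).1

/-- Sperner's lemma for dominating sets of vertices. -/
theorem exists_dominating_image_eq_univ [Nonempty I] (N : ℕ) (c : (I → ℕ) → I) :
    ∃ R : Finset (I ⊕ Finset.piAntidiag (Finset.univ : Finset I) N),
      R.card = Fintype.card I ∧ IsDominating (slackOrder N) R ∧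
      R.image (Sum.elim id fun a => c a.1) = Finset.univ := by
  classical
  obtain ⟨i₀⟩ := ‹Nonempty I›
  let V := I ⊕ Finset.piAntidiag (Finset.univ : Finset I) N
  let col : V → I := Sum.elim id fun a => c a.1
  let rooms : Finset (Finset V) := Finset.univ.filter fun R =>
    R.card = Fintype.card I ∧ IsDominating (slackOrder N) R
  have hrooms : ∀ R, R ∈ rooms ↔ R.card = Fintype.card I ∧ IsDominating (slackOrder N) R := by
    intro R; simp [rooms]
  let g₀ : Finset.piAntidiag (Finset.univ : Finset I) N :=
    ⟨Pi.single i₀ N, by simp [Finset.mem_piAntidiag]⟩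
  let τ₀ : Finset V := (Finset.univ.erase i₀).image Sum.inl
  have hτ₀ : τ₀.card + 1 = Fintype.card I := by
    rw [Finset.card_image_of_injective _ Sum.inl_injective,
      Finset.card_erase_add_one (Finset.mem_univ _), Finset.card_univ]
  have hτ₀' : τ₀.image col = Finset.univ.erase i₀ := by
    rw [Finset.image_image]
    exact Finset.image_id
  have hmemτ₀ : ∀ j : I, (Sum.inl j : V) ∈ τ₀ ↔ j ≠ i₀ := by intro j; simp [τ₀]
  have hnot : ∀ a, (Sum.inr a : V) ∉ τ₀ := by intro a; simp [τ₀]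
  have hodd : Odd (rooms.filter fun R => τ₀ ⊆ R).card := by
    obtain ⟨a, -, ha⟩ := Finset.exists_max_image
      (Finset.univ : Finset (Finset.piAntidiag (Finset.univ : Finset I) N))
      (fun a => slackOrder N i₀ (Sum.inr a)) ⟨g₀, Finset.mem_univ _⟩
    -- In order `i ≠ i₀` the slack vertex `i` of `τ₀` lies below every grid point, so `a` must be
    -- dominated through `i₀`; this forces the added vertex to be `a`.
    have : (rooms.filter fun R => τ₀ ⊆ R) = {insert (Sum.inr a) τ₀} := by
      ext R
      simp only [Finset.mem_filter, hrooms, Finset.mem_singleton]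
      constructor
      · rintro ⟨⟨hRc, hRd⟩, hs⟩
        obtain ⟨z, hz⟩ := Finset.card_eq_one.1 (show (R \ τ₀).card = 1
          by rw [Finset.card_sdiff_of_subset hs]; omega)
        have hzm : z ∈ R \ τ₀ := by rw [hz]; simp
        obtain ⟨hzR, hzτ⟩ := Finset.mem_sdiff.1 hzm
        obtain rfl : R = insert z τ₀ := by
          rw [← Finset.sdiff_union_of_subset hs, hz]; rfl
        obtain ⟨i, hi⟩ := hRd (Sum.inr a)
        obtain rfl : i = i₀ := by
          by_contra hne
          have := slackHeight_le (hi (Sum.inl i)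
            (Finset.mem_insert_of_mem ((hmemτ₀ i).2 hne)))
          simp [slackHeight] at this
        have hzi := hi z (Finset.mem_insert_self _ _)
        rcases z with j | b
        · exfalso
          by_cases hj : j = i
          · have := slackHeight_le hzi
            simp [slackHeight, hj] at this
          · exact hzτ ((hmemτ₀ j).2 hj)
        · rw [slackOrder_injective N i (le_antisymm hzi (ha b (Finset.mem_univ _)))]
      · rintro rfl
        refine ⟨⟨?_, ?_⟩, Finset.subset_insert _ _⟩
        · rw [Finset.card_insert_of_notMem (hnot a), hτ₀]
        · rintro (j | b)
          · refine ⟨j, fun x hx => ?_⟩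
            by_cases hxj : x = Sum.inl j
            · rw [hxj]
            · refine (slackOrder_lt ?_).le
              rcases x with l | x
              · have : l ≠ j := fun h => hxj (by rw [h])
                simp [slackHeight, this]
              · simp [slackHeight]
          · refine ⟨i₀, fun x hx => ?_⟩
            rcases Finset.mem_insert.1 hx with rfl | hx
            · exact ha b (Finset.mem_univ _)
            · rcases x with l | x
              · refine (slackOrder_lt ?_).le
                have h1 := (hmemτ₀ l).1 hx
                have h2 := piAntidiag_apply_le b i₀
                simp only [slackHeight, if_neg h1]
                omega
              · exact absurd hx (hnot x)
    rw [this, Finset.card_singleton]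
    exact odd_one
  have heven : ∀ τ : Finset V, τ ≠ τ₀ → τ.card + 1 = Fintype.card I →
      τ.image col = Finset.univ.erase i₀ → Even (rooms.filter fun R => τ ⊆ R).card := by
    intro τ hne hcard himg
    have hτne : τ.Nonempty := by
      rw [Finset.nonempty_iff_ne_empty]
      rintro rfl
      apply hne
      rw [eq_comm, ← Finset.card_eq_zero]
      simp at hcard
      omega
    refine even_card_dominating_supersets (slackOrder_injective N) hcard hτne ?_ rooms hrooms
    intro k
    refine ⟨Sum.inl k, fun l hl => ?_⟩
    by_contra! hcon
    -- Height `N + 2` is reached only by slack vertices. These are coloured by their own index, so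
    -- the colours identify `τ` as `τ₀`.
    have hslack : ∀ t ∈ τ, ∃ q, q ≠ l ∧ t = Sum.inl q := by
      intro t ht
      have h := slackHeight_le (hcon t ht)
      rcases t with q | a
      · refine ⟨q, ?_, rfl⟩
        rintro rfl
        simp [slackHeight, hl.symm] at h
      · have := piAntidiag_apply_le a l
        simp only [slackHeight, if_neg hl.symm] at h
        omega
    apply hne
    refine Finset.eq_of_subset_of_card_le (fun t ht => ?_) (by omega)
    obtain ⟨q, hq, rfl⟩ := hslack t ht
    rw [hmemτ₀]
    have : q ∈ τ.image col := Finset.mem_image.2 ⟨_, ht, rfl⟩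
    rw [himg] at this
    exact Finset.ne_of_mem_erase this
  obtain ⟨R, hR, hRi⟩ := exists_image_eq_univ_of_parity col i₀ rooms
    (fun R hR => ((hrooms R).1 hR).1) τ₀ hτ₀ hτ₀' hodd heven
  exact ⟨R, ((hrooms R).1 hR).1, ((hrooms R).1 hR).2, hRi⟩

/-- Sperner's lemma on the grid of a simplex: some grid point `a` has, for every colour `i`, either
a small coordinate `i` or a grid point of colour `i` nearby. -/
theorem exists_grid_point_near_all_colours [Nonempty I] (N : ℕ) (c : (I → ℕ) → I) :
    ∃ a : I → ℕ, ∑ i, a i = N ∧ ∀ i, a i < Fintype.card I ∨ ∃ b : I → ℕ, ∑ i, b i = N ∧ c b = i ∧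
      ∀ j, a j < b j + Fintype.card I ∧ b j < a j + Fintype.card I := by
  classical
  obtain ⟨R, hRc, hRd, hRi⟩ := exists_dominating_image_eq_univ N c
  have hsum : ∀ a : Finset.piAntidiag (Finset.univ : Finset I) N, ∑ i, a.1 i = N := fun a =>
    (Finset.mem_piAntidiag.1 a.2).1
  have hRne : R.Nonempty := by
    rw [← Finset.card_pos, hRc]
    exact Fintype.card_pos
  let i₀ : I := Classical.arbitrary I
  let g₀ : Finset.piAntidiag (Finset.univ : Finset I) N :=
    ⟨Pi.single i₀ N, by simp [Finset.mem_piAntidiag]⟩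
  choose m hm hmin using fun i => Finset.exists_min_image R (slackHeight N i) hRne
  let μ : I → ℕ := fun i => slackHeight N i (m i)
  -- Without grid points the colours force all slack vertices into `R`, each of height 0 in its own
  -- order, and `g₀` is not dominated.
  obtain ⟨a, ha⟩ : ∃ a, Sum.inr a ∈ R := by
    by_contra! hcon
    obtain ⟨i, hi⟩ := hRd (Sum.inr g₀)
    have : i ∈ R.image (Sum.elim id fun a => c a.1) := by rw [hRi]; simp
    obtain ⟨t, ht, hti⟩ := Finset.mem_image.1 this
    rcases t with q | b
    · have hq : q = i := hti
      have := slackHeight_le (hi _ ht)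
      simp [slackHeight, hq] at this
    · exact hcon b ht
  -- Otherwise some grid point `y ≥ μ` exists, whose heights `y i + 1` exceed all the minima.
  have hμ : N < ∑ i, μ i := by
    by_contra! hcon
    let y : I → ℕ := fun i => μ i + if i = i₀ then N - ∑ i, μ i else 0
    have hy : ∑ i, y i = N := by
      simp only [y, Finset.sum_add_distrib, Finset.sum_ite_eq', Finset.mem_univ, if_true]
      omega
    obtain ⟨i, hi⟩ := hRd (Sum.inr ⟨y, by simp [Finset.mem_piAntidiag, hy]⟩)
    have := slackHeight_le (hi _ (hm i))
    simp only [slackHeight, y] at this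
    change _ ≤ μ i at this
    omega
  -- The excesses of the heights over `μ` are nonnegative and total less than `Fintype.card I`.
  have hnear : ∀ b, Sum.inr b ∈ R → ∀ i, μ i ≤ b.1 i + 1 ∧ b.1 i + 1 < μ i + Fintype.card I := by
    intro b hb i
    have hle : ∀ i, μ i ≤ b.1 i + 1 := fun i => hmin i _ hb
    refine ⟨hle i, ?_⟩
    have h1 : ∑ j, (b.1 j + 1) = N + Fintype.card I := by
      rw [Finset.sum_add_distrib, hsum b]; simp
    have h2 := Finset.sum_erase_add Finset.univ (fun j => b.1 j + 1) (Finset.mem_univ i)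
    have h3 := Finset.sum_erase_add Finset.univ μ (Finset.mem_univ i)
    have h4 : ∑ j ∈ Finset.univ.erase i, μ j ≤ ∑ j ∈ Finset.univ.erase i, (b.1 j + 1) :=
      Finset.sum_le_sum fun j _ => hle j
    omega
  refine ⟨a.1, hsum a, fun i => ?_⟩
  have : i ∈ R.image (Sum.elim id fun a => c a.1) := by rw [hRi]; simp
  obtain ⟨t, ht, hti⟩ := Finset.mem_image.1 this
  rcases t with q | b
  · left
    have hq : q = i := hti
    have h1 := hmin i _ ht
    have h2 := (hnear a ha i).2
    simp only [slackHeight, hq, if_true] at h1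
    change μ i ≤ 0 at h1
    omega
  · right
    refine ⟨b.1, hsum b, hti, fun j => ?_⟩
    have h1 := hnear a ha j
    have h2 := hnear b ht j
    omega

end Grid

/-! ### From Sperner to KKM and Brouwer -/

/-- A form of the Knaster-Kuratowski-Mazurkiewicz lemma: if at each point of the simplex one of the
continuous functions `φ i` is nonnegative, then there is a point where each of them is, except for
those whose coordinate vanishes. -/
theorem exists_mem_stdSimplex_forall_eq_zero_or_nonneg {I : Type*} [Fintype I] [Nonempty I]
    (φ : I → (I → ℝ) → ℝ) (hφ : ∀ i, ContinuousOn (φ i) (stdSimplex ℝ I))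
    (h : ∀ z ∈ stdSimplex ℝ I, ∃ i, 0 ≤ φ i z) :
    ∃ z ∈ stdSimplex ℝ I, ∀ i, z i = 0 ∨ 0 ≤ φ i z := by
  classical
  let n := Fintype.card I
  let pt : ℕ → (I → ℕ) → I → ℝ := fun N a i => a i / (N + 1 : ℝ)
  have hpt : ∀ N a, ∑ i, a i = N + 1 → pt N a ∈ stdSimplex ℝ I := by
    intro N a ha
    refine ⟨fun i => by positivity, ?_⟩
    simp only [pt]
    rw [← Finset.sum_div, ← Nat.cast_sum, ha]
    push_cast
    exact div_self (by positivity)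
  have hcol : ∀ N, ∃ c : (I → ℕ) → I, ∀ a, ∑ i, a i = N + 1 → 0 ≤ φ (c a) (pt N a) := by
    intro N
    have : ∀ a : I → ℕ, ∃ i, ∑ i, a i = N + 1 → 0 ≤ φ i (pt N a) := by
      intro a
      by_cases ha : ∑ i, a i = N + 1
      · obtain ⟨i, hi⟩ := h _ (hpt N a ha)
        exact ⟨i, fun _ => hi⟩
      · exact ⟨Classical.arbitrary I, fun h => absurd h ha⟩
    choose c hc using this
    exact ⟨c, hc⟩
  choose c hc using hcol
  choose a ha hab using fun N => exists_grid_point_near_all_colours (N + 1) (c N)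
  obtain ⟨z, hz, ψ, hψ, hlim⟩ := (isCompact_stdSimplex ℝ I).tendsto_subseq
    (fun N => hpt N (a N) (ha N))
  refine ⟨z, hz, fun i => ?_⟩
  have hzero : Filter.Tendsto (fun N => (n : ℝ) / ((ψ N : ℝ) + 1)) Filter.atTop (nhds 0) :=
    ((tendsto_const_div_atTop_nhds_zero_nat (n : ℝ)).comp
      (Filter.tendsto_add_atTop_nat 1)).comp hψ.tendsto_atTop |>.congr fun N => by
        simp
  -- Either coordinate `i` is at most `n / (ψ N + 1)` infinitely often, or eventually points of
  -- colour `i` lie that close and also tend to `z`.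
  by_cases hfr : ∃ᶠ N in Filter.atTop, a (ψ N) i < Fintype.card I
  · left
    refine le_antisymm ?_ (hz.1 i)
    have h1 : Filter.Tendsto (fun N => pt (ψ N) (a (ψ N)) i) Filter.atTop (nhds (z i)) :=
      (tendsto_pi_nhds.1 hlim) i
    have h2 : Filter.Tendsto (fun N => pt (ψ N) (a (ψ N)) i - (n : ℝ) / ((ψ N : ℝ) + 1))
        Filter.atTop (nhds (z i)) := by simpa using h1.sub hzero
    refine le_of_tendsto_of_frequently h2 ?_
    refine hfr.mono fun N hN => ?_
    have : (a (ψ N) i : ℝ) ≤ n := by exact_mod_cast hN.le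
    simp only [pt]
    rw [sub_nonpos]
    gcongr
  · right
    rw [Filter.not_frequently] at hfr
    have hev : ∀ᶠ N in Filter.atTop, ∃ b : I → ℕ, ∑ i, b i = ψ N + 1 ∧ c (ψ N) b = i ∧
      ∀ j, a (ψ N) j < b j + Fintype.card I ∧ b j < a (ψ N) j + Fintype.card I :=
      hfr.mono fun N hN => (hab (ψ N) i).resolve_left hN
    choose b hb using fun N => (show ∃ w : I → ℝ, (∃ b : I → ℕ, ∑ i, b i = ψ N + 1 ∧ c (ψ N) b = i ∧
      ∀ j, a (ψ N) j < b j + Fintype.card I ∧ b j < a (ψ N) j + Fintype.card I) →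
      w ∈ stdSimplex ℝ I ∧ 0 ≤ φ i w ∧
        ∀ j, |w j - pt (ψ N) (a (ψ N)) j| ≤ (n : ℝ) / ((ψ N : ℝ) + 1) by
      by_cases hex : ∃ b : I → ℕ, ∑ i, b i = ψ N + 1 ∧ c (ψ N) b = i ∧
        ∀ j, a (ψ N) j < b j + Fintype.card I ∧ b j < a (ψ N) j + Fintype.card I
      · obtain ⟨b, hb, hbi, hbj⟩ := hex
        refine ⟨pt (ψ N) b, fun _ => ⟨hpt _ _ hb, ?_, fun j => ?_⟩⟩
        · have := hc (ψ N) b hb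
          rwa [hbi] at this
        · simp only [pt]
          rw [← sub_div, abs_div, abs_of_pos (show (0 : ℝ) < (ψ N : ℝ) + 1 by positivity)]
          gcongr
          have h1 : (a (ψ N) j : ℝ) < b j + n := by exact_mod_cast (hbj j).1
          have h2 : (b j : ℝ) < a (ψ N) j + n := by exact_mod_cast (hbj j).2
          rw [abs_le]
          constructor <;> linarith
      · exact ⟨0, fun h => absurd h hex⟩)
    have hblim : Filter.Tendsto b Filter.atTop (nhds z) := by
      rw [tendsto_pi_nhds]
      intro j
      have h1 : Filter.Tendsto (fun N => pt (ψ N) (a (ψ N)) j) Filter.atTop (nhds (z j)) :=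
        (tendsto_pi_nhds.1 hlim) j
      have h2 : Filter.Tendsto (fun N => b N j - pt (ψ N) (a (ψ N)) j) Filter.atTop (nhds 0) :=
        squeeze_zero_norm' (hev.mono fun N hN => (hb N hN).2.2 j) hzero
      simpa using h2.add h1
    have hbw : Filter.Tendsto b Filter.atTop (nhdsWithin z (stdSimplex ℝ I)) :=
      tendsto_nhdsWithin_iff.2 ⟨hblim, hev.mono fun N hN => (hb N hN).1⟩
    exact ge_of_tendsto ((hφ i z hz).tendsto.comp hbw) (hev.mono fun N hN => (hb N hN).2.1)

/-- Brouwer's fixed point theorem for the standard simplex. -/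
theorem exists_fixedPoint_stdSimplex {I : Type*} [Fintype I] [Nonempty I]
    (f : (I → ℝ) → I → ℝ) (hf : ContinuousOn f (stdSimplex ℝ I))
    (hmaps : Set.MapsTo f (stdSimplex ℝ I) (stdSimplex ℝ I)) :
    ∃ z ∈ stdSimplex ℝ I, f z = z := by
  obtain ⟨z, hz, hzi⟩ := exists_mem_stdSimplex_forall_eq_zero_or_nonneg (fun i z => f z i - z i)
    (fun i => ((continuous_apply i).comp_continuousOn hf).sub (continuous_apply i).continuousOn)
    (by
      intro z hz
      by_contra! hcon
      have := Finset.sum_lt_sum_of_nonempty Finset.univ_nonempty fun i _ => hcon i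
      rw [Finset.sum_sub_distrib, (hmaps hz).2, hz.2] at this
      simp at this)
  refine ⟨z, hz, ?_⟩
  have hle : ∀ i ∈ Finset.univ, z i ≤ f z i := by
    intro i _
    rcases hzi i with h | h
    · rw [h]; exact (hmaps hz).1 i
    · linarith
  have := (Finset.sum_eq_sum_iff_of_le hle).1 (by rw [(hmaps hz).2, hz.2])
  exact funext fun i => (this i (Finset.mem_univ i)).symm

/-- Brouwer's fixed point theorem for a box. -/
theorem exists_fixedPoint_Icc {ι : Type*} [Fintype ι] {a b : ι → ℝ} (hab : a ≤ b)
    (f : (ι → ℝ) → ι → ℝ) (hf : ContinuousOn f (Set.Icc a b))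
    (hmaps : Set.MapsTo f (Set.Icc a b) (Set.Icc a b)) :
    ∃ z ∈ Set.Icc a b, f z = z := by
  -- Scaled by `L`, the box embeds in the simplex, with `none` as slack coordinate. The map `u`
  -- truncates back; at the fixed point the truncation is inactive because `f` stays in the box.
  let L : ℝ := ∑ i, (b i - a i) + 1
  have hL : 0 < L := by
    have : 0 ≤ ∑ i, (b i - a i) := Finset.sum_nonneg fun i _ => sub_nonneg.2 (hab i)
    simp only [L]; linarith
  let u : (Option ι → ℝ) → ι → ℝ := fun w i => min (b i) (a i + L * w (some i))
  have hu : Continuous u := by fun_prop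
  have humem : ∀ w ∈ stdSimplex ℝ (Option ι), u w ∈ Set.Icc a b := by
    intro w hw
    refine ⟨fun i => le_min (hab i) ?_, fun i => min_le_left _ _⟩
    have := mul_nonneg hL.le (hw.1 (some i))
    linarith
  let g : (Option ι → ℝ) → Option ι → ℝ := fun w o =>
    o.elim (1 - ∑ i, (f (u w) i - a i) / L) fun i => (f (u w) i - a i) / L
  have hfu : ContinuousOn (fun w => f (u w)) (stdSimplex ℝ (Option ι)) :=
    hf.comp hu.continuousOn humem
  have hfi : ∀ i, ContinuousOn (fun w => f (u w) i) (stdSimplex ℝ (Option ι)) := fun i =>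
    (continuous_apply i).comp_continuousOn hfu
  have hg : ContinuousOn g (stdSimplex ℝ (Option ι)) := by
    rw [continuousOn_pi]
    rintro (_ | i)
    · exact continuousOn_const.sub (continuousOn_finsetSum _ fun i _ =>
        ((hfi i).sub continuousOn_const).div_const L)
    · exact ((hfi i).sub continuousOn_const).div_const L
  have hgm : Set.MapsTo g (stdSimplex ℝ (Option ι)) (stdSimplex ℝ (Option ι)) := by
    intro w hw
    have hm := hmaps (humem w hw)
    refine ⟨?_, ?_⟩
    · rintro (_ | i)
      · change 0 ≤ 1 - ∑ i, (f (u w) i - a i) / L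
        rw [← Finset.sum_div, sub_nonneg, div_le_one hL]
        have : ∑ i, (f (u w) i - a i) ≤ ∑ i, (b i - a i) :=
          Finset.sum_le_sum fun i _ => sub_le_sub_right (hm.2 i) _
        simp only [L]; linarith
      · exact div_nonneg (sub_nonneg.2 (hm.1 i)) hL.le
    · rw [Fintype.sum_option]
      exact sub_add_cancel _ _
  obtain ⟨w, hw, hgw⟩ := exists_fixedPoint_stdSimplex g hg hgm
  refine ⟨u w, humem w hw, ?_⟩
  funext i
  have h1 : (f (u w) i - a i) / L = w (some i) := congrFun hgw (some i)
  have h2 : a i + L * w (some i) = f (u w) i := by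
    rw [← h1]; field_simp; ring
  change _ = min (b i) (a i + L * w (some i))
  rw [h2, min_eq_right ((hmaps (humem w hw)).2 i)]

/-! ### Complementarity on a box and the capped equilibrium -/

/-- Existence of a solution of a variational inequality on a box, in coordinates. -/
theorem exists_box_complementarity {ι : Type*} [Fintype ι] {a b : ι → ℝ} (hab : a ≤ b)
    (F : (ι → ℝ) → ι → ℝ) (hF : ContinuousOn F (Set.Icc a b)) :
    ∃ z ∈ Set.Icc a b, ∀ i, (0 < F z i → z i = a i) ∧ (F z i < 0 → z i = b i) := by
  let f : (ι → ℝ) → ι → ℝ := fun z i => max (a i) (min (b i) (z i - F z i))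
  have hf : ContinuousOn f (Set.Icc a b) := by
    rw [continuousOn_pi]
    intro i
    exact continuousOn_const.sup (continuousOn_const.inf
      ((continuous_apply i).continuousOn.sub ((continuous_apply i).comp_continuousOn hF)))
  obtain ⟨z, hz, hfz⟩ := exists_fixedPoint_Icc hab f hf fun z _ =>
    ⟨fun i => le_max_left _ _, fun i => max_le (hab i) (min_le_left _ _)⟩
  refine ⟨z, hz, fun i => ?_⟩
  have h : max (a i) (min (b i) (z i - F z i)) = z i := congrFun hfz i
  have h1 := hz.1 i
  have h2 := hz.2 i
  constructor <;> intro hi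
  · rcases le_total (a i) (min (b i) (z i - F z i)) with h3 | h3
    · rw [max_eq_right h3] at h
      have := min_le_right (b i) (z i - F z i)
      linarith
    · rw [max_eq_left h3] at h
      exact h.symm
  · rcases le_total (b i) (z i - F z i) with h3 | h3
    · rw [min_eq_left h3, max_eq_right (hab i)] at h
      exact h.symm
    · rw [min_eq_right h3] at h
      have := le_max_right (a i) (z i - F z i)
      linarith

/-- Existence of an elastic-demand equilibrium, with multipliers, when the demands are bounded above
by a common constant. -/
theorem exists_elastic_equilibrium {S : Type*} {P B : S → Type*} [Fintype S]
    [∀ s, Fintype (P s)] [∀ s, Fintype (B s)]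
    (g : (s : S) → P s → ((s : S) → P s → ℝ) → ℝ) (h : (s : S) → B s → ((s : S) → B s → ℝ) → ℝ)
    (hg : ∀ s p, ContinuousOn (g s p) {x | ∀ s p, 0 ≤ x s p})
    (hh : ∀ s j, ContinuousOn (h s j) {y | ∀ s j, 0 ≤ y s j}) {M : ℝ} (hM : 0 ≤ M) :
    ∃ (x : (s : S) → P s → ℝ) (y : (s : S) → B s → ℝ) (l : S → ℝ),
      (∀ s p, 0 ≤ x s p) ∧ (∀ s j, 0 ≤ y s j) ∧ (∀ s j, y s j ≤ M) ∧
      (∀ s, ∑ p, x s p = ∑ j, y s j) ∧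
      (∀ s p, l s ≤ g s p x) ∧ (∀ s p, 0 < x s p → g s p x ≤ l s) ∧
      (∀ s j, y s j < M → h s j y ≤ l s) ∧ (∀ s j, 0 < y s j → l s ≤ h s j y) := by
  -- Strictly more than any balanced flow can carry, so the upper bound on path flows is never
  -- active.
  let X : ℝ := ∑ s, (Fintype.card (B s) : ℝ) * M + 1
  have hXs : ∀ s, (Fintype.card (B s) : ℝ) * M < X := fun s => by
    have := Finset.single_le_sum (f := fun s => (Fintype.card (B s) : ℝ) * M)
      (fun s _ => by positivity) (Finset.mem_univ s)
    simp only [X]; linarith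
  have hX : 0 ≤ X := by
    have : 0 ≤ ∑ s, (Fintype.card (B s) : ℝ) * M := Finset.sum_nonneg fun s _ => by positivity
    simp only [X]; linarith
  let boxX : Set ((s : S) → P s → ℝ) := Set.Icc 0 fun _ _ => X
  let boxY : Set ((s : S) → B s → ℝ) := Set.Icc 0 fun _ _ => M
  have hgc : ∀ s p, ContinuousOn (g s p) boxX := fun s p =>
    (hg s p).mono fun x hx s p => hx.1 s p
  have hhc : ∀ s j, ContinuousOn (h s j) boxY := fun s j =>
    (hh s j).mono fun y hy s j => hy.1 s j
  obtain ⟨C₁, hC₁⟩ := (isCompact_Icc : IsCompact boxX).exists_bound_of_continuousOn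
    (f := fun x s p => g s p x) (continuousOn_pi.2 fun s => continuousOn_pi.2 fun p => hgc s p)
  obtain ⟨C₂, hC₂⟩ := (isCompact_Icc : IsCompact boxY).exists_bound_of_continuousOn
    (f := fun y s j => h s j y) (continuousOn_pi.2 fun s => continuousOn_pi.2 fun j => hhc s j)
  let L : ℝ := max 0 (max C₁ C₂) + 1
  have hL0 : 0 < L := by
    have := le_max_left 0 (max C₁ C₂)
    simp only [L]; linarith
  have hgL : ∀ x ∈ boxX, ∀ s p, |g s p x| < L := by
    intro x hx s p
    have h1 := (norm_le_pi_norm (fun p => g s p x) p).trans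
      ((norm_le_pi_norm (fun s p => g s p x) s).trans (hC₁ x hx))
    have h2 := (le_max_left C₁ C₂).trans (le_max_right 0 (max C₁ C₂))
    rw [Real.norm_eq_abs] at h1
    simp only [L]; linarith
  have hhL : ∀ y ∈ boxY, ∀ s j, |h s j y| < L := by
    intro y hy s j
    have h1 := (norm_le_pi_norm (fun j => h s j y) j).trans
      ((norm_le_pi_norm (fun s j => h s j y) s).trans (hC₂ y hy))
    have h2 := (le_max_right C₁ C₂).trans (le_max_right 0 (max C₁ C₂))
    rw [Real.norm_eq_abs] at h1
    simp only [L]; linarith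
  let ι := ((s : S) × P s) ⊕ ((s : S) × B s) ⊕ S
  let lo : ι → ℝ := Sum.elim (fun _ => 0) (Sum.elim (fun _ => 0) fun _ => -L)
  let hi : ι → ℝ := Sum.elim (fun _ => X) (Sum.elim (fun _ => M) fun _ => L)
  let xo : (ι → ℝ) → (s : S) → P s → ℝ := fun z s p => z (Sum.inl ⟨s, p⟩)
  let yo : (ι → ℝ) → (s : S) → B s → ℝ := fun z s j => z (Sum.inr (Sum.inl ⟨s, j⟩))
  let lam : (ι → ℝ) → S → ℝ := fun z s => z (Sum.inr (Sum.inr s))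
  have hxo : Continuous xo := by fun_prop
  have hyo : Continuous yo := by fun_prop
  have hlam : Continuous lam := by fun_prop
  have hxob : Set.MapsTo xo (Set.Icc lo hi) boxX := fun z hz =>
    ⟨fun s p => hz.1 (Sum.inl ⟨s, p⟩), fun s p => hz.2 (Sum.inl ⟨s, p⟩)⟩
  have hyob : Set.MapsTo yo (Set.Icc lo hi) boxY := fun z hz =>
    ⟨fun s j => hz.1 (Sum.inr (Sum.inl ⟨s, j⟩)), fun s j => hz.2 (Sum.inr (Sum.inl ⟨s, j⟩))⟩
  let F : (ι → ℝ) → ι → ℝ := fun z => Sum.elim (fun q => g q.1 q.2 (xo z) - lam z q.1)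
    (Sum.elim (fun q => lam z q.1 - h q.1 q.2 (yo z)) fun s => ∑ p, xo z s p - ∑ j, yo z s j)
  have hlohi : lo ≤ hi := by
    rintro (q | q | s)
    · exact hX
    · exact hM
    · change -L ≤ L
      linarith
  have hF : ContinuousOn F (Set.Icc lo hi) := by
    rw [continuousOn_pi]
    rintro (q | q | s)
    · exact ((hgc q.1 q.2).comp hxo.continuousOn hxob).sub
        ((continuous_apply q.1).comp hlam).continuousOn
    · exact ((continuous_apply q.1).comp hlam).continuousOn.sub
        ((hhc q.1 q.2).comp hyo.continuousOn hyob)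
    · refine Continuous.continuousOn ?_
      change Continuous fun z => ∑ p, xo z s p - ∑ j, yo z s j
      fun_prop
  obtain ⟨z, hz, hcomp⟩ := exists_box_complementarity hlohi F hF
  have hzx := hxob hz
  have hzy := hyob hz
  have hpX : ∀ s p, g s p (xo z) - lam z s < 0 → xo z s p = X := fun s p =>
    (hcomp (Sum.inl ⟨s, p⟩)).2
  have hp0 : ∀ s p, 0 < g s p (xo z) - lam z s → xo z s p = 0 := fun s p =>
    (hcomp (Sum.inl ⟨s, p⟩)).1
  have hjM : ∀ s j, lam z s - h s j (yo z) < 0 → yo z s j = M := fun s j =>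
    (hcomp (Sum.inr (Sum.inl ⟨s, j⟩))).2
  have hj0 : ∀ s j, 0 < lam z s - h s j (yo z) → yo z s j = 0 := fun s j =>
    (hcomp (Sum.inr (Sum.inl ⟨s, j⟩))).1
  have hsL : ∀ s, ∑ p, xo z s p - ∑ j, yo z s j < 0 → lam z s = L := fun s =>
    (hcomp (Sum.inr (Sum.inr s))).2
  have hs0 : ∀ s, 0 < ∑ p, xo z s p - ∑ j, yo z s j → lam z s = -L := fun s =>
    (hcomp (Sum.inr (Sum.inr s))).1
  have hbal : ∀ s, ∑ p, xo z s p = ∑ j, yo z s j := by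
    intro s
    -- A shortage of flow pushes the multiplier to `L > h`, so all demands vanish; an excess pushes
    -- it to `-L < g`, so all flows vanish. Either contradicts the sign.
    rcases lt_trichotomy (∑ p, xo z s p - ∑ j, yo z s j) 0 with hE | hE | hE
    · have hl := hsL s hE
      have h1 : ∀ j, yo z s j = 0 := fun j => hj0 s j (by
        have := (abs_lt.1 (hhL _ hzy s j)).2
        linarith)
      have h2 : 0 ≤ ∑ p, xo z s p := Finset.sum_nonneg fun p _ => hzx.1 s p
      simp only [h1, Finset.sum_const_zero, sub_zero] at hE
      linarith
    · linarith
    · have hl := hs0 s hE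
      have h1 : ∀ p, xo z s p = 0 := fun p => hp0 s p (by
        have := (abs_lt.1 (hgL _ hzx s p)).1
        linarith)
      have h2 : 0 ≤ ∑ j, yo z s j := Finset.sum_nonneg fun j _ => hzy.1 s j
      simp only [h1, Finset.sum_const_zero, zero_sub] at hE
      linarith
  have hxlt : ∀ s p, xo z s p < X := by
    intro s p
    have h1 : xo z s p ≤ ∑ p, xo z s p :=
      Finset.single_le_sum (fun p _ => hzx.1 s p) (Finset.mem_univ p)
    have h2 : ∑ j, yo z s j ≤ ∑ _j : B s, M := Finset.sum_le_sum fun j _ => hzy.2 s j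
    rw [Finset.sum_const, Finset.card_univ, nsmul_eq_mul] at h2
    have := hbal s
    have := hXs s
    linarith
  refine ⟨xo z, yo z, lam z, hzx.1, hzy.1, hzy.2, hbal, fun s p => ?_, fun s p hp => ?_,
    fun s j hj => ?_, fun s j hj => ?_⟩
  · by_contra! hcon
    exact (hxlt s p).ne (hpX s p (by linarith))
  · by_contra! hcon
    exact hp.ne' (hp0 s p (by linarith))
  · by_contra! hcon
    exact hj.ne (hjM s j (by linarith))
  · by_contra! hcon
    exact hj.ne' (hj0 s j (by linarith))

/-! ### Application to the network -/

namespace ElasticNetwork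

variable {V A U : Type*}

theorem incidence_nonneg (p : List A) (a : A) : 0 ≤ incidence p a := by
  unfold incidence
  split_ifs <;> norm_num

theorem continuous_arcFlow (N : ElasticNetwork V A U) : Continuous N.arcFlow := by
  unfold arcFlow
  fun_prop

theorem arcFlow_nonneg (N : ElasticNetwork V A U) {x : N.PathFlow} (hx : ∀ s p, 0 ≤ x s p)
    (a : A) : 0 ≤ N.arcFlow x a :=
  Finset.sum_nonneg fun s _ => Finset.sum_nonneg fun p _ =>
    mul_nonneg (incidence_nonneg p.1 a) (hx s p)

theorem continuousOn_pathCost [Fintype A] (N : ElasticNetwork V A U) {c : A → (A → ℝ) → ℝ}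
    (hc : ∀ a, ContinuousOn (c a) {f : A → ℝ | ∀ a', 0 ≤ f a'}) (s : N.odPairs) (p : N.paths s) :
    ContinuousOn (fun x => N.pathCost c x s p) {x | ∀ s p, 0 ≤ x s p} :=
  continuousOn_finsetSum _ fun a _ => continuousOn_const.mul
    ((hc a).comp N.continuous_arcFlow.continuousOn fun _ hx => N.arcFlow_nonneg hx)

end ElasticNetwork

theorem theorem4p1 {V A U : Type*} [Finite V] [Fintype A] (N : ElasticNetwork V A U)
    (γ : (s : N.odPairs) → N.users s → EReal)
    (c : A → (A → ℝ) → ℝ) (h : (s : N.odPairs) → N.users s → N.Demand → ℝ)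
    (hγ : ∀ s, ∀ j : N.users s, γ s j = ⊤)
    (hW : (N.feasibleSet γ).Nonempty)
    (hc : ∀ a, ContinuousOn (c a) {f : A → ℝ | ∀ a', 0 ≤ f a'})
    (hh : ∀ s, ∀ j : N.users s,
      ContinuousOn (h s j) {y : N.Demand | ∀ s', ∀ j' : N.users s', 0 ≤ y s' j'})
    (hC : N.Coercive γ c h) :
    ∃ w, N.SolvesVI γ c h w := by
  obtain ⟨r, hr, hcoer⟩ := hC
  obtain ⟨x, y, l, hx, hy, hyM, hbal, hlg, hgl, hhl, hlh⟩ := exists_elastic_equilibrium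
    (fun s p x => N.pathCost c x s p) h (N.continuousOn_pathCost hc) hh
    (show 0 ≤ r + 1 by linarith)
  have hfeas : (x, y) ∈ N.feasibleSet γ := fun s =>
    ⟨hbal s, hx s, fun j => ⟨hy s j, by rw [hγ]; exact le_top⟩⟩
  have hhl' : ∀ s j, h s j y ≤ l s := by
    intro s j
    rcases (hyM s j).lt_or_eq with hj | hj
    · exact hhl s j hj
    -- A demand at the cap `r + 1` exceeds `r`, so (C1) applies.
    · obtain ⟨p, hp, hpj⟩ := hcoer _ hfeas s j (by simp only [hj]; linarith)
      exact hpj.trans (hgl s p hp)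
  refine ⟨(x, y), hfeas, fun v hv => ?_⟩
  rw [← Finset.sum_sub_distrib]
  refine Finset.sum_nonneg fun s _ => ?_
  obtain ⟨hvbal, hvx, hvy⟩ := hv s
  -- Equality holds where `x s p > 0`; elsewhere the cost is at least `l s` and the increment is
  -- nonnegative.
  have h1 : ∑ p, l s * (v.1 s p - x s p) ≤ ∑ p, N.pathCost c x s p * (v.1 s p - x s p) := by
    refine Finset.sum_le_sum fun p _ => ?_
    have h2 := mul_le_mul_of_nonneg_right (hlg s p) (hvx p)
    rcases (hx s p).eq_or_lt with h0 | h0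
    · rw [← h0]; simpa using h2
    · rw [le_antisymm (hgl s p h0) (hlg s p)]
  have h2 : ∑ j, h s j y * (v.2 s j - y s j) ≤ ∑ j, l s * (v.2 s j - y s j) := by
    refine Finset.sum_le_sum fun j _ => ?_
    have h2 := mul_le_mul_of_nonneg_right (hhl' s j) (hvy j).1
    rcases (hy s j).eq_or_lt with h0 | h0
    · rw [← h0]; simpa using h2
    · rw [le_antisymm (hhl' s j) (hlh s j h0)]
  rw [← Finset.mul_sum, Finset.sum_sub_distrib] at h1 h2
  rw [hvbal, hbal s] at h1
  exact sub_nonneg.2 (h2.trans h1)
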